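/- Consider an instance of the Steiner Forest problem: a finite graph $G=(V,E)$ with non-negative edge costs $(c_e)_{e\in E}$ and a collection $\mathcal D$ of demand pairs $\{a,b\}\subseteq V$; the two vertices of a demand pair are called partners. A set $U\subseteq V$ separates a pair if it contains exactly one of its two vertices, and $\delta(U)\subseteq E$ is the set of edges separated by $U$. Let $\varepsilon\ge 0$. The $\varepsilon$-extended moat-growing algorithm on this instance maintains, at each time $t\ge 0$, dual variables $y_U(t)\ge 0$ ($U\subseteq V$), the set $F$ of tight edges, i.e. of edges $e$ with $\sum_{U:e\in\delta(U)}y_U(t)=c_e$, the collection $\mathcal C^t$ of (vertex sets of) connected components of $(V,F)$, and a budget $b_S(t)\ge 0$ for every $S\in\mathcal C^t$. At time $0$ all dual variables and budgets are $0$. A component is demand-active if it separates some demand pair, budget-active if it is not demand-active but has positive budget, and active if it is one of the two; $\mathcal A^t\subseteq\mathcal C^t$ is the collection of active components. As time grows, the dual variables of all active components grow at unit rate and all others stay unchanged; the budget of a demand-active component grows at rate $\varepsilon$, the budget of a budget-active component decreases at unit rate, and the budgets of inactive components stay unchanged. Whenever edges become tight they are added to $F$, and the budget of each resulting component is the sum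 of the budgets of the components merged into it; $\mathcal C^t$, $\mathcal A^t$ and the budgets at such a time refer to the situation after the merge. The deactivation time of $v\in V$ is the largest $\tau\in[0,\infty]$ such that $v$ belongs to an active component at all times $s<\tau$. Vertices $u,v$ are actively connected if there is a time $t$ such that $u,v$ lie in a common component of $\mathcal C^t$ and both have deactivation time at least $t$; this is an equivalence relation. A set $S\subseteq V$ is actively connected if it is contained in one of its equivalence classes. For $S\subseteq V$ let $\mathrm{cost}(S)$ be the minimum of $\sum_{e\in F}c_e$ over all edge sets $F\subseteq E$ such that all vertices of $S$ lie in the same connected component of $(V,F)$, and for a collection $\mathcal S$ of vertex sets let $\mathrm{cost}(\mathcal S)=\sum_{S\in\mathcal S}\mathrm{cost}(S)$. For a collection $\mathcal S$ of actively connected sets let $$\mathrm{gain}(\mathcal S)=2\int_0^\infty\big(|\mathcal A^t|-|\mathcal A^t/\mathcal S|\big)\,dt,$$ where $\mathcal A^t/\mathcal S$ arises from $\mathcal A^t$ by merging sets of $\mathcal A^t$ into a single set whenever they are intersected by the same set $S\in\mathcal S$. Then for every integer $k\ge 2$ and every actively connected set $S\subseteq V$ there is a collection $\mathcal S_k$ of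 subsets of $S$, each containing at most $k$ elements, such that $$\mathrm{cost}(\mathcal S_k)\le\Big(1+\frac{1}{\lfloor\log_2 k\rfloor}\Big)\cdot\mathrm{cost}(S)\qquad\text{and}\qquad \mathrm{gain}(\mathcal S_k)=\mathrm{gain}(\{S\}),$$ the integrals defining both gains being finite. -/

import Mathlib

/-- An instance of the Steiner Forest problem on the vertex set `V`: a graph, edge costs that are
non-negative on its edges, and a collection of demand pairs. -/
structure SteinerForest (V : Type*) where
  graph : SimpleGraph V
  cost : Sym2 V → ℝ
  cost_nonneg : ∀ e ∈ graph.edgeSet, 0 ≤ cost e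
  demands : Finset (Sym2 V)

/-- What the moat-growing algorithm keeps track of at one moment: the time, the dual variables
`y_U`, and the budgets `b_S`, which are meaningful for the current components `S`. The set `F` of
tight edges and the components are determined by the dual variables, see below. -/
structure MoatState (V : Type*) where
  time : ℝ
  dual : Finset V → ℝ
  budget : Finset V → ℝ

namespace SteinerForest

noncomputable section

open scoped Classical

variable {V : Type*} [Fintype V] (I : SteinerForest V) (ε : ℝ)

/-- `U` separates the pair `e`: exactly one end of `e` is in `U`. For an edge `e` of the graph this
says `e ∈ δ(U)`. -/
def Separates (U : Finset V) (e : Sym2 V) : Prop :=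
  ∃ u ∈ U, ∃ v ∉ U, e = s(u, v)

/-- `∑_{U : e ∈ δ(U)} y_U`. -/
def load (s : MoatState V) (e : Sym2 V) : ℝ :=
  ∑ U : Finset V with Separates U e, s.dual U

/-- The graph `(V, F)`, where `F` is the set of all tight edges. -/
def tightGraph (s : MoatState V) : SimpleGraph V :=
  SimpleGraph.fromEdgeSet {e | e ∈ I.graph.edgeSet ∧ load s e = I.cost e}

/-- The vertex sets of the connected components of `(V, F)`. -/
def components (s : MoatState V) : Finset (Finset V) :=
  Finset.univ.image fun v => Finset.univ.filter fun w => (I.tightGraph s).Reachable v w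

/-- Some vertex of `S` has a partner outside `S`. -/
def DemandActive (S : Finset V) : Prop :=
  ∃ d ∈ I.demands, Separates S d

def BudgetActive (s : MoatState V) (S : Finset V) : Prop :=
  ¬ I.DemandActive S ∧ 0 < s.budget S

/-- The active components. -/
def active (s : MoatState V) : Finset (Finset V) :=
  (I.components s).filter fun S => I.DemandActive S ∨ I.BudgetActive s S

/-- The number of active components that `e` leaves; the rate at which the load of `e` grows. -/
def rate (s : MoatState V) (e : Sym2 V) : ℕ :=
  ((I.active s).filter fun S => Separates S e).card

/-- The waiting times until the next events: an edge whose load is growing becomes tight, or the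
budget of a budget-active component is used up. -/
def waitingTimes (s : MoatState V) : Finset ℝ :=
  ((Finset.univ.filter fun e : Sym2 V => e ∈ I.graph.edgeSet ∧ 0 < I.rate s e).image
      fun e => (I.cost e - load s e) / I.rate s e) ∪
    (((I.components s).filter fun S => I.BudgetActive s S).image fun S => s.budget S)

/-- The waiting time until the next event, `⊤` if no event happens any more. -/
def wait (s : MoatState V) : WithTop ℝ :=
  (I.waitingTimes s).min

/-- Growth for a duration `δ` with an unchanged collection of active components: the dual variable
of every active component grows at unit rate, the budget of every demand-active component grows at
rate `ε`, and the budget of every budget-active component decreases at unit rate. -/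
def evolve (s : MoatState V) (δ : ℝ) : MoatState V where
  time := s.time + δ
  dual U := if U ∈ I.active s then s.dual U + δ else s.dual U
  budget S :=
    if S ∈ I.active s then
      if I.DemandActive S then s.budget S + ε * δ else s.budget S - δ
    else s.budget S

/-- The state right after the next event: all newly tight edges have been added, and the budget of
each new component is the sum of the budgets of the old components that it consists of. -/
def next (s : MoatState V) : MoatState V where
  time := (I.evolve ε s ((I.wait s).untopD 0)).time
  dual := (I.evolve ε s ((I.wait s).untopD 0)).dual
  budget S :=
    ∑ C ∈ (I.components s).filter fun C => C ⊆ S, (I.evolve ε s ((I.wait s).untopD 0)).budget C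

/-- The state of the `ε`-extended moat-growing algorithm after its `n`-th event. -/
def stateSeq : ℕ → MoatState V
  | 0 => { time := 0, dual := fun _ => 0, budget := fun _ => 0 }
  | n + 1 => I.next ε (stateSeq n)

/-- The number of events up to and including time `t`: the first `n` such that the event after the
`n`-th one comes later than `t` or never. -/
def eventCount (t : ℝ) : ℕ :=
  sInf {n : ℕ | (t : WithTop ℝ) < ((I.stateSeq ε n).time : WithTop ℝ) + I.wait (I.stateSeq ε n)}

/-- The state of the `ε`-extended moat-growing algorithm at time `t ≥ 0`. -/
def stateAt (t : ℝ) : MoatState V :=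
  I.evolve ε (I.stateSeq ε (I.eventCount ε t)) (t - (I.stateSeq ε (I.eventCount ε t)).time)

/-- The collection `𝒞ᵗ` of components at time `t`. -/
def componentsAt (t : ℝ) : Finset (Finset V) :=
  I.components (I.stateAt ε t)

/-- The collection `𝒜ᵗ` of active components at time `t`. -/
def activeAt (t : ℝ) : Finset (Finset V) :=
  I.active (I.stateAt ε t)

/-- The deactivation time of `v`: the largest `τ` such that `v` lies in an active component at all
times before `τ` (`⊤` if `v` always does). -/
def deactivationTime (v : V) : EReal :=
  sSup {τ : EReal | ∀ r : ℝ, 0 ≤ r → (r : EReal) < τ → ∃ S ∈ I.activeAt ε r, v ∈ S}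

/-- Actively connected vertices. -/
def ActivelyConnectedVertices (u v : V) : Prop :=
  ∃ t : ℝ, 0 ≤ t ∧ (∃ S ∈ I.componentsAt ε t, u ∈ S ∧ v ∈ S) ∧
    (t : EReal) ≤ I.deactivationTime ε u ∧ (t : EReal) ≤ I.deactivationTime ε v

/-- `A` is an actively connected set: it is contained in the class of some vertex. -/
def ActivelyConnected (A : Finset V) : Prop :=
  ∃ u : V, ∀ v ∈ A, I.ActivelyConnectedVertices ε u v

/-- `𝒜 / 𝒮`: the members of `𝒜` are merged into a single set whenever they are intersected by the
same set of `𝒮`. -/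
def mergeBy (𝒜 𝒮 : Finset (Finset V)) : Finset (Finset V) :=
  𝒜.image fun U =>
    (𝒜.filter fun W =>
      Relation.EqvGen
        (fun X Y => X ∈ 𝒜 ∧ Y ∈ 𝒜 ∧ ∃ S ∈ 𝒮, (S ∩ X).Nonempty ∧ (S ∩ Y).Nonempty) U W).sup id

/-- `|𝒜ᵗ| - |𝒜ᵗ / 𝒮|`. -/
def gainRate (𝒮 : Finset (Finset V)) (t : ℝ) : ℝ :=
  ((I.activeAt ε t).card : ℝ) - ((mergeBy (I.activeAt ε t) 𝒮).card : ℝ)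

/-- `gain(𝒮)`. -/
def gain (𝒮 : Finset (Finset V)) : ℝ :=
  2 * ∫ t in Set.Ici (0 : ℝ), I.gainRate ε 𝒮 t

/-- `cost(S)`: the minimum cost of a set `F` of edges such that all vertices of `S` belong to the
same connected component of `(V, F)`. -/
def steinerCost (S : Finset V) : ℝ :=
  sInf {x : ℝ | ∃ F : Finset (Sym2 V), (F : Set (Sym2 V)) ⊆ I.graph.edgeSet ∧
    (∀ u ∈ S, ∀ v ∈ S, (SimpleGraph.fromEdgeSet (F : Set (Sym2 V))).Reachable u v) ∧
    x = ∑ e ∈ F, I.cost e}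

/-- `cost(𝒮)` for a collection of vertex sets. -/
def collectionCost (𝒮 : Finset (Finset V)) : ℝ :=
  ∑ S ∈ 𝒮, I.steinerCost S

end

end SteinerForest

/-! It suffices to find sets of at most `k` elements inside `S` that link any two vertices of `S` by
a chain (`Connects`) and are cheap enough. Such a collection has the same gain as `{S}`, even at
each time `t ≥ 0` (`mergeBy_eq_of_connects`). If all vertices of `S` lie in active components, the
chains merge all these components, exactly as `S` does. If some vertex of `S` lies in an inactive
component, active connectedness forces all of `S` into that component (`compAt_eq_of_inactive`), and
neither collection merges anything. The gain rate is bounded, and it vanishes once `S` lies in one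
component, so the integrals are finite. The cost bound is that of `k`-restricted Steiner trees. An
optimal Steiner tree is turned into a full binary tree with leaf set `S` (`exists_spanning`,
`exists_prune`), which is cut at every `(q + 1)`-st level, where `q + 1 = ⌊log₂ k⌋`. A piece has at
most `2 ^ (q + 1) ≤ k` lower ends. Each cut node is represented in the piece above it by a leaf,
reached by going right once and then always left. These paths are edge-disjoint over all nodes, so
they cost at most one tree in total; averaging over the `q + 1` offsets of the cuts gives an offset
with surcharge at most `1 / (q + 1)` of the tree. -/

namespace SteinerForest

noncomputable section

open scoped Classical

variable {V : Type*} [Fintype V] (I : SteinerForest V) (ε : ℝ)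

/-! ### Components and growth between two events. -/

/-- The vertex set of the component of `v`. -/
def compOf (s : MoatState V) (v : V) : Finset V :=
  Finset.univ.filter fun w => (I.tightGraph s).Reachable v w

variable {I ε}

theorem mem_compOf {s : MoatState V} {v w : V} :
    w ∈ I.compOf s v ↔ (I.tightGraph s).Reachable v w := by
  simp [compOf]

theorem mem_compOf_self (s : MoatState V) (v : V) : v ∈ I.compOf s v :=
  mem_compOf.2 (SimpleGraph.Reachable.refl v)

theorem mem_components {s : MoatState V} {C : Finset V} :
    C ∈ I.components s ↔ ∃ v, I.compOf s v = C := by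
  simp [components, compOf]

theorem compOf_mem_components (s : MoatState V) (v : V) : I.compOf s v ∈ I.components s :=
  mem_components.2 ⟨v, rfl⟩

theorem compOf_eq_iff {s : MoatState V} {v w : V} :
    I.compOf s v = I.compOf s w ↔ (I.tightGraph s).Reachable v w := by
  constructor
  · intro h
    rw [← mem_compOf, h]
    exact mem_compOf_self s w
  · intro h
    ext x
    rw [mem_compOf, mem_compOf]
    exact ⟨fun h' => h.symm.trans h', fun h' => h.trans h'⟩

theorem eq_compOf_of_mem {s : MoatState V} {C : Finset V} (hC : C ∈ I.components s) {v : V}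
    (hv : v ∈ C) : C = I.compOf s v := by
  obtain ⟨w, rfl⟩ := mem_components.1 hC
  exact compOf_eq_iff.2 (mem_compOf.1 hv)

theorem mem_active {s : MoatState V} {C : Finset V} :
    C ∈ I.active s ↔ C ∈ I.components s ∧ (I.DemandActive C ∨ I.BudgetActive s C) := by
  simp [active]

theorem not_separates_of_tight {s : MoatState V} {C : Finset V} (hC : C ∈ I.components s)
    {e : Sym2 V} (he : e ∈ I.graph.edgeSet) (ht : load s e = I.cost e) : ¬ Separates C e := by
  rintro ⟨u, hu, v, hv, rfl⟩
  have huv : u ≠ v := fun h => hv (h ▸ hu)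
  apply hv
  rw [eq_compOf_of_mem hC hu, mem_compOf]
  apply SimpleGraph.Adj.reachable
  simp only [tightGraph, SimpleGraph.fromEdgeSet_adj]
  exact ⟨⟨he, ht⟩, huv⟩

theorem load_evolve (s : MoatState V) (δ : ℝ) (e : Sym2 V) :
    load (I.evolve ε s δ) e = load s e + I.rate s e * δ := by
  have h : ∀ U : Finset V, (I.evolve ε s δ).dual U
      = s.dual U + if U ∈ I.active s then δ else 0 := by
    intro U
    by_cases hU : U ∈ I.active s <;> simp [evolve, hU]
  simp only [load, h, Finset.sum_add_distrib, rate]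
  rw [← Finset.sum_filter, Finset.sum_const, nsmul_eq_mul]
  congr 4
  ext U
  simp [and_comm]

theorem rate_eq_zero_of_tight {s : MoatState V} {e : Sym2 V} (he : e ∈ I.graph.edgeSet)
    (ht : load s e = I.cost e) : I.rate s e = 0 := by
  rw [rate, Finset.card_eq_zero, Finset.filter_eq_empty_iff]
  exact fun C hC => not_separates_of_tight (mem_active.1 hC).1 he ht

/-- Both ends of a tight edge lie in the same component, so no active set separates it and its load
is frozen. -/
theorem tightGraph_le_evolve (s : MoatState V) (δ : ℝ) :
    I.tightGraph s ≤ I.tightGraph (I.evolve ε s δ) := by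
  apply SimpleGraph.fromEdgeSet_mono
  rintro e ⟨he, ht⟩
  refine ⟨he, ?_⟩
  rw [load_evolve, rate_eq_zero_of_tight he ht, ht]
  simp

theorem tightGraph_le_next (s : MoatState V) : I.tightGraph s ≤ I.tightGraph (I.next ε s) :=
  tightGraph_le_evolve (ε := ε) s _

theorem wait_le_edge {s : MoatState V} {e : Sym2 V} (he : e ∈ I.graph.edgeSet)
    (hr : 0 < I.rate s e) : I.wait s ≤ ((I.cost e - load s e) / I.rate s e : ℝ) := by
  apply Finset.min_le
  apply Finset.mem_union_left
  exact Finset.mem_image.2 ⟨e, by simp [he, hr], rfl⟩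

theorem wait_le_budget {s : MoatState V} {C : Finset V} (hC : C ∈ I.components s)
    (hb : I.BudgetActive s C) : I.wait s ≤ (s.budget C : ℝ) := by
  apply Finset.min_le
  apply Finset.mem_union_right
  exact Finset.mem_image.2 ⟨C, by simp [hC, hb], rfl⟩

/-- Before the next event a growing load is still strictly below the cost of its edge. No lower
bound on `δ` is needed. -/
theorem tightGraph_evolve {s : MoatState V} {δ : ℝ} (hδ : (δ : WithTop ℝ) < I.wait s) :
    I.tightGraph (I.evolve ε s δ) = I.tightGraph s := by
  apply le_antisymm _ (tightGraph_le_evolve s δ)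
  apply SimpleGraph.fromEdgeSet_mono
  rintro e ⟨he, ht⟩
  refine ⟨he, ?_⟩
  rw [load_evolve] at ht
  rcases Nat.eq_zero_or_pos (I.rate s e) with h0 | h0
  · simpa [h0] using ht
  · have h1 := WithTop.coe_lt_coe.1 (hδ.trans_le (wait_le_edge he h0))
    have h2 : (0 : ℝ) < I.rate s e := by exact_mod_cast h0
    rw [lt_div_iff₀ h2] at h1
    nlinarith

theorem components_evolve {s : MoatState V} {δ : ℝ} (hδ : (δ : WithTop ℝ) < I.wait s) :
    I.components (I.evolve ε s δ) = I.components s := by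
  simp only [components, tightGraph_evolve hδ]

theorem active_evolve {s : MoatState V} {δ : ℝ} (hδ : (δ : WithTop ℝ) < I.wait s) :
    I.active (I.evolve ε s δ) = I.active s := by
  ext C
  rw [mem_active, mem_active, components_evolve hδ]
  refine and_congr_right fun hC => ?_
  by_cases hd : I.DemandActive C
  · simp [hd]
  · simp only [hd, false_or, BudgetActive, not_false_eq_true, true_and]
    by_cases hb : 0 < s.budget C
    · have h1 : C ∈ I.active s := mem_active.2 ⟨hC, Or.inr ⟨hd, hb⟩⟩
      have h2 := WithTop.coe_lt_coe.1 (hδ.trans_le (wait_le_budget hC ⟨hd, hb⟩))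
      simp [evolve, h1, hd, hb, h2]
    · have h1 : C ∉ I.active s := fun h => by
        rcases (mem_active.1 h).2 with h | h
        · exact hd h
        · exact hb h.2
      simp [evolve, h1]

theorem compOf_subset_of_le {s s' : MoatState V} (h : I.tightGraph s ≤ I.tightGraph s') (v : V) :
    I.compOf s v ⊆ I.compOf s' v := fun _ hw => mem_compOf.2 ((mem_compOf.1 hw).mono h)

/-- The union of the components that meet `C`. -/
def enlarge (I : SteinerForest V) (s : MoatState V) (C : Finset V) : Finset V :=
  C.biUnion fun v => I.compOf s v

theorem enlarge_compOf {s s' : MoatState V} (h : I.tightGraph s ≤ I.tightGraph s') (v : V) :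
    I.enlarge s' (I.compOf s v) = I.compOf s' v := by
  ext w
  simp only [enlarge, Finset.mem_biUnion, mem_compOf]
  constructor
  · rintro ⟨x, hx, hw⟩
    exact (hx.mono h).trans hw
  · exact fun hw => ⟨v, SimpleGraph.Reachable.refl v, hw⟩

theorem components_eq_image {s s' : MoatState V} (h : I.tightGraph s ≤ I.tightGraph s') :
    I.components s' = (I.components s).image (I.enlarge s') := by
  ext C
  rw [mem_components, Finset.mem_image]
  constructor
  · rintro ⟨v, rfl⟩
    exact ⟨_, compOf_mem_components s v, enlarge_compOf h v⟩
  · rintro ⟨D, hD, rfl⟩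
    obtain ⟨v, rfl⟩ := mem_components.1 hD
    exact ⟨v, (enlarge_compOf h v).symm⟩

/-! ### Termination: only finitely many events occur. -/

/-- Activity is inherited, never created. A vertex with a partner outside the new component already
had that partner outside its old one; a positive total budget has a positive summand, and an
inactive component has no positive budget, neither before nor after growth. -/
theorem exists_active_of_active_next {s : MoatState V} {C : Finset V}
    (hC : C ∈ I.active (I.next ε s)) : ∃ D ∈ I.active s, I.enlarge (I.next ε s) D = C := by
  have hle : I.tightGraph s ≤ I.tightGraph (I.next ε s) := tightGraph_le_next s
  have hkey : ∀ D ∈ I.components s, ∀ v ∈ D, v ∈ C → I.enlarge (I.next ε s) D = C := by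
    intro D hD v hv hvC
    rw [eq_compOf_of_mem hD hv, enlarge_compOf hle, ← eq_compOf_of_mem (mem_active.1 hC).1 hvC]
  rcases (mem_active.1 hC).2 with ⟨d, hd, u, hu, v, hv, rfl⟩ | ⟨hnd, hb⟩
  · refine ⟨I.compOf s u, mem_active.2 ⟨compOf_mem_components s u, Or.inl
      ⟨_, hd, u, mem_compOf_self s u, v, fun h => hv ?_, rfl⟩⟩,
      hkey _ (compOf_mem_components s u) u (mem_compOf_self s u) hu⟩
    rw [eq_compOf_of_mem (mem_active.1 hC).1 hu]
    exact compOf_subset_of_le hle u h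
  · obtain ⟨D, hD, hDb⟩ := Finset.exists_lt_of_sum_lt (s := (I.components s).filter fun D => D ⊆ C)
      (f := fun _ => (0 : ℝ)) (g := (I.evolve ε s ((I.wait s).untopD 0)).budget)
      (by rw [Finset.sum_const_zero]; exact hb)
    obtain ⟨hD, hDC⟩ := Finset.mem_filter.1 hD
    obtain ⟨v, rfl⟩ := mem_components.1 hD
    refine ⟨_, ?_, hkey _ hD v (mem_compOf_self s v) (hDC (mem_compOf_self s v))⟩
    by_contra hna
    simp only [evolve, if_neg hna] at hDb
    exact hna (mem_active.2 ⟨hD, or_iff_not_imp_left.2 fun h => ⟨h, hDb⟩⟩)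

/-- A quantity that every event decreases. -/
def potential (I : SteinerForest V) (s : MoatState V) : ℕ :=
  (I.components s).card + (I.active s).card

theorem potential_next_lt {s : MoatState V} (hw : I.wait s ≠ ⊤) :
    I.potential (I.next ε s) < I.potential s := by
  have hle : I.tightGraph s ≤ I.tightGraph (I.next ε s) := tightGraph_le_next s
  have hcomp := components_eq_image hle
  have hact : I.active (I.next ε s) ⊆ (I.active s).image (I.enlarge (I.next ε s)) := fun C hC =>
    Finset.mem_image.2 (exists_active_of_active_next hC)
  have h1 : (I.components (I.next ε s)).card ≤ (I.components s).card := by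
    rw [hcomp]
    exact Finset.card_image_le
  have h2 : (I.active (I.next ε s)).card ≤ (I.active s).card :=
    (Finset.card_le_card hact).trans Finset.card_image_le
  -- Failure of injectivity means that two components merge, so the number of components drops.
  -- Otherwise the event must be an exhausted budget, and the number of active components drops.
  by_cases hinj : Set.InjOn (I.enlarge (I.next ε s)) (I.components s)
  swap
  · have h3 : (I.components (I.next ε s)).card ≠ (I.components s).card := fun h => by
      rw [hcomp] at h
      exact hinj (Finset.card_image_iff.1 h)
    unfold potential
    omega
  obtain ⟨w, hw'⟩ := WithTop.ne_top_iff_exists.1 hw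
  have hmem : w ∈ I.waitingTimes s := Finset.mem_of_min hw'.symm
  rcases Finset.mem_union.1 hmem with hx | hx
  · obtain ⟨e, he, hew⟩ := Finset.mem_image.1 hx
    simp only [Finset.mem_filter, Finset.mem_univ, true_and] at he
    obtain ⟨C, hC⟩ := Finset.card_pos.1 he.2
    obtain ⟨hCa, u, hu, v, hv, rfl⟩ := Finset.mem_filter.1 hC
    have hC := (mem_active.1 hCa).1
    have hr : (0 : ℝ) < I.rate s s(u, v) := by exact_mod_cast he.2
    have hadj : (I.tightGraph (I.next ε s)).Adj u v := by
      simp only [tightGraph, SimpleGraph.fromEdgeSet_adj]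
      refine ⟨⟨he.1, ?_⟩, fun h => hv (h ▸ hu)⟩
      change load (I.evolve ε s _) _ = _
      rw [load_evolve, ← hw', WithTop.untopD_coe, ← hew]
      field_simp
      ring
    exfalso
    have h3 : I.enlarge (I.next ε s) (I.compOf s u) = I.enlarge (I.next ε s) (I.compOf s v) := by
      rw [enlarge_compOf hle, enlarge_compOf hle]
      exact compOf_eq_iff.2 hadj.reachable
    have h4 := hinj (compOf_mem_components s u) (compOf_mem_components s v) h3
    apply hv
    rw [eq_compOf_of_mem hC hu, h4]
    exact mem_compOf_self s v
  · obtain ⟨C, hC, hbw⟩ := Finset.mem_image.1 hx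
    obtain ⟨hC, hnd, hb⟩ := Finset.mem_filter.1 hC
    have hCa : C ∈ I.active s := mem_active.2 ⟨hC, Or.inr ⟨hnd, hb⟩⟩
    have hfix : ∀ D ∈ I.components s, I.enlarge (I.next ε s) D = D := by
      intro D hD
      obtain ⟨v, rfl⟩ := mem_components.1 hD
      rw [enlarge_compOf hle]
      apply Finset.Subset.antisymm _ (compOf_subset_of_le hle v)
      intro x hx
      have h3 : I.enlarge (I.next ε s) (I.compOf s x) = I.enlarge (I.next ε s) (I.compOf s v) := by
        rw [enlarge_compOf hle, enlarge_compOf hle]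
        exact (compOf_eq_iff.2 (mem_compOf.1 hx)).symm
      rw [← hinj (compOf_mem_components s x) (compOf_mem_components s v) h3]
      exact mem_compOf_self s x
    have hsub : I.active (I.next ε s) ⊆ (I.active s).erase C := by
      intro D hD
      obtain ⟨D', hD', rfl⟩ := exists_active_of_active_next hD
      rw [hfix D' (mem_active.1 hD').1] at hD ⊢
      refine Finset.mem_erase.2 ⟨?_, hD'⟩
      rintro rfl
      rcases (mem_active.1 hD).2 with h | ⟨-, h⟩
      · exact hnd h
      -- Nothing merges, so the new budget has a single summand, the old budget minus a waiting time
      -- equal to it, which is zero.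
      · have hflt : ((I.components s).filter fun E => E ⊆ D') = {D'} := by
          ext E
          simp only [Finset.mem_filter, Finset.mem_singleton]
          constructor
          · rintro ⟨hE, hED⟩
            obtain ⟨v, rfl⟩ := mem_components.1 hE
            exact (eq_compOf_of_mem hC (hED (mem_compOf_self s v))).symm
          · rintro rfl
            exact ⟨hC, Finset.Subset.refl _⟩
        simp only [next, hflt, Finset.sum_singleton, evolve, hCa, if_true, hnd, if_false, ← hw',
          WithTop.untopD_coe, hbw] at h
        simp at h
    have h3 := (Finset.card_le_card hsub).trans_lt (Finset.card_erase_lt_of_mem hCa)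
    unfold potential
    omega

theorem exists_wait_eq_top (I : SteinerForest V) (ε : ℝ) :
    ∃ n, I.wait (I.stateSeq ε n) = ⊤ := by
  by_contra! h
  have hn : ∀ n, I.potential (I.stateSeq ε n) + n ≤ I.potential (I.stateSeq ε 0) := by
    intro n
    induction n with
    | zero => simp
    | succ n ih =>
      have := potential_next_lt (ε := ε) (h n)
      change I.potential (I.next ε (I.stateSeq ε n)) + (n + 1) ≤ _
      omega
  have := hn (I.potential (I.stateSeq ε 0) + 1)
  omega

/-! ### The process at real times and active connectedness. -/

/-- Termination makes the set whose infimum defines `eventCount` nonempty, so the infimum is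
attained and is not the default value `0` of `sInf ∅`. -/
theorem lt_of_eventCount (I : SteinerForest V) (ε t : ℝ) :
    (t : WithTop ℝ) < ((I.stateSeq ε (I.eventCount ε t)).time : WithTop ℝ)
      + I.wait (I.stateSeq ε (I.eventCount ε t)) := by
  obtain ⟨n, hn⟩ := exists_wait_eq_top I ε
  exact Nat.sInf_mem (s := {n : ℕ | (t : WithTop ℝ) < ((I.stateSeq ε n).time : WithTop ℝ)
    + I.wait (I.stateSeq ε n)}) ⟨n, by simp [hn]⟩

theorem eventCount_mono (I : SteinerForest V) (ε : ℝ) : Monotone (I.eventCount ε) := by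
  intro t t' h
  apply Nat.sInf_le
  exact (WithTop.coe_le_coe.2 h).trans_lt (lt_of_eventCount I ε t')

theorem elapsed_lt_wait (I : SteinerForest V) (ε t : ℝ) :
    ((t - (I.stateSeq ε (I.eventCount ε t)).time : ℝ) : WithTop ℝ)
      < I.wait (I.stateSeq ε (I.eventCount ε t)) := by
  have h := lt_of_eventCount I ε t
  cases hw : I.wait (I.stateSeq ε (I.eventCount ε t)) with
  | top => exact WithTop.coe_lt_top _
  | coe w =>
    rw [hw, ← WithTop.coe_add, WithTop.coe_lt_coe] at h
    rw [WithTop.coe_lt_coe]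
    linarith

theorem componentsAt_eq (I : SteinerForest V) (ε t : ℝ) :
    I.componentsAt ε t = I.components (I.stateSeq ε (I.eventCount ε t)) :=
  components_evolve (elapsed_lt_wait I ε t)

theorem activeAt_eq (I : SteinerForest V) (ε t : ℝ) :
    I.activeAt ε t = I.active (I.stateSeq ε (I.eventCount ε t)) :=
  active_evolve (elapsed_lt_wait I ε t)

theorem tightGraph_stateSeq_mono (I : SteinerForest V) (ε : ℝ) :
    Monotone fun n => I.tightGraph (I.stateSeq ε n) :=
  monotone_nat_of_le_succ fun n => tightGraph_le_next (I.stateSeq ε n)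

/-- The component of `v` at time `t`. -/
def compAt (I : SteinerForest V) (ε t : ℝ) (v : V) : Finset V :=
  I.compOf (I.stateSeq ε (I.eventCount ε t)) v

theorem mem_compAt_self (t : ℝ) (v : V) : v ∈ I.compAt ε t v := mem_compOf_self _ v

theorem eq_compAt_of_mem {t : ℝ} {C : Finset V} (hC : C ∈ I.componentsAt ε t) {v : V}
    (hv : v ∈ C) : C = I.compAt ε t v := by
  rw [componentsAt_eq] at hC
  exact eq_compOf_of_mem hC hv

theorem activeAt_subset (t : ℝ) : I.activeAt ε t ⊆ I.componentsAt ε t := by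
  intro C hC
  exact (mem_active.1 hC).1

theorem compAt_eq_mono {t t' : ℝ} (h : t ≤ t') {u v : V} (huv : I.compAt ε t u = I.compAt ε t v) :
    I.compAt ε t' u = I.compAt ε t' v :=
  compOf_eq_iff.2 ((compOf_eq_iff.1 huv).mono
    (tightGraph_stateSeq_mono I ε (eventCount_mono I ε h)))

theorem ActivelyConnectedVertices.exists_time {u v : V}
    (h : I.ActivelyConnectedVertices ε u v) :
    ∃ t : ℝ, I.compAt ε t u = I.compAt ε t v ∧
      (t : EReal) ≤ I.deactivationTime ε u ∧ (t : EReal) ≤ I.deactivationTime ε v := by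
  obtain ⟨t, -, ⟨C, hC, hu, hv⟩, h1, h2⟩ := h
  exact ⟨t, (eq_compAt_of_mem hC hu).symm.trans (eq_compAt_of_mem hC hv), h1, h2⟩

theorem deactivationTime_le {t : ℝ} (ht : 0 ≤ t) {v : V} (hv : I.compAt ε t v ∉ I.activeAt ε t) :
    I.deactivationTime ε v ≤ t := by
  apply sSup_le
  intro τ hτ
  by_contra! hlt
  obtain ⟨C, hC, hvC⟩ := hτ t ht hlt
  rw [eq_compAt_of_mem (activeAt_subset t hC) hvC] at hC
  exact hv hC

/-- The vertex `v` has deactivation time at most `t`, so it met the representative `u` of its class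
by time `t` and shares its inactive component. Hence `u` is deactivated by time `t` as well, and the
same argument applies to `u` and `w`. -/
theorem compAt_eq_of_inactive {S : Finset V} (hS : I.ActivelyConnected ε S) {t : ℝ} (ht : 0 ≤ t)
    {v w : V} (hv : v ∈ S) (hw : w ∈ S) (hin : I.compAt ε t v ∉ I.activeAt ε t) :
    I.compAt ε t v = I.compAt ε t w := by
  obtain ⟨u, hu⟩ := hS
  obtain ⟨t₁, he₁, -, hv₁⟩ := (hu v hv).exists_time
  obtain ⟨t₂, he₂, hu₂, -⟩ := (hu w hw).exists_time
  have h1 : t₁ ≤ t := EReal.coe_le_coe_iff.1 (hv₁.trans (deactivationTime_le ht hin))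
  have huv := compAt_eq_mono h1 he₁
  rw [← huv] at hin ⊢
  have h2 : t₂ ≤ t := EReal.coe_le_coe_iff.1 (hu₂.trans (deactivationTime_le ht hin))
  exact compAt_eq_mono h2 he₂

theorem ActivelyConnected.exists_time {S : Finset V} (hS : I.ActivelyConnected ε S) :
    ∃ T : ℝ, ∀ t, T ≤ t → ∀ v ∈ S, ∀ w ∈ S, I.compAt ε t v = I.compAt ε t w := by
  obtain ⟨u, hu⟩ := hS
  have h1 : ∀ v ∈ S, ∃ t, I.compAt ε t u = I.compAt ε t v := fun v hv => by
    obtain ⟨t, ht, -⟩ := (hu v hv).exists_time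
    exact ⟨t, ht⟩
  choose! τ hτ using h1
  obtain ⟨T, hT⟩ := (S.image τ).bddAbove
  refine ⟨T, fun t ht v hv w hw => ?_⟩
  have h2 : ∀ v ∈ S, I.compAt ε t u = I.compAt ε t v := fun v hv =>
    compAt_eq_mono ((hT (Finset.mem_image_of_mem τ hv)).trans ht) (hτ v hv)
  exact (h2 v hv).symm.trans (h2 w hw)

/-! ### Equality of gains and finiteness of the integrals. -/

/-- Every two vertices of `S` are linked by a chain of sets in `𝒮`. -/
def Connects (𝒮 : Finset (Finset V)) (S : Finset V) : Prop :=
  ∀ x ∈ S, ∀ y ∈ S, Relation.EqvGen (fun a b => ∃ B ∈ 𝒮, a ∈ B ∧ b ∈ B) x y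

/-- Two sets of `𝒜` are merged directly. -/
def Touch (𝒜 𝒮 : Finset (Finset V)) (X Y : Finset V) : Prop :=
  X ∈ 𝒜 ∧ Y ∈ 𝒜 ∧ ∃ S ∈ 𝒮, (S ∩ X).Nonempty ∧ (S ∩ Y).Nonempty

theorem eqvGen_of_forall {α : Type*} {r r' : α → α → Prop}
    (h : ∀ x y, r x y → Relation.EqvGen r' x y) {x y : α} (hxy : Relation.EqvGen r x y) :
    Relation.EqvGen r' x y := by
  induction hxy with
  | rel x y hr => exact h x y hr
  | refl x => exact .refl x
  | symm x y _ ih => exact .symm _ _ ih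
  | trans x y z _ _ ih₁ ih₂ => exact .trans _ _ _ ih₁ ih₂

omit [Fintype V] in
theorem mergeBy_congr {𝒜 𝒮 𝒮' : Finset (Finset V)}
    (h : ∀ X Y, Touch 𝒜 𝒮 X Y → Relation.EqvGen (Touch 𝒜 𝒮') X Y)
    (h' : ∀ X Y, Touch 𝒜 𝒮' X Y → Relation.EqvGen (Touch 𝒜 𝒮) X Y) :
    mergeBy 𝒜 𝒮 = mergeBy 𝒜 𝒮' := by
  unfold mergeBy
  apply Finset.image_congr
  intro U _
  dsimp only
  congr 1
  apply Finset.filter_congr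
  intro W _
  exact ⟨eqvGen_of_forall h, eqvGen_of_forall h'⟩

omit [Fintype V] in
theorem mergeBy_empty (𝒜 : Finset (Finset V)) : mergeBy 𝒜 ∅ = 𝒜 := by
  have hrel : ∀ X Y, Relation.EqvGen (fun X Y => X ∈ 𝒜 ∧ Y ∈ 𝒜 ∧ ∃ S ∈ (∅ : Finset (Finset V)),
      (S ∩ X).Nonempty ∧ (S ∩ Y).Nonempty) X Y → X = Y := by
    intro X Y h
    induction h with
    | rel x y hr => simp at hr
    | refl x => rfl
    | symm x y _ ih => exact ih.symm
    | trans x y z _ _ ih₁ ih₂ => exact ih₁.trans ih₂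
  conv_rhs => rw [← Finset.image_id (s := 𝒜)]
  unfold mergeBy
  apply Finset.image_congr
  intro U hU
  have hflt : (𝒜.filter fun W => Relation.EqvGen (fun X Y => X ∈ 𝒜 ∧ Y ∈ 𝒜 ∧
      ∃ S ∈ (∅ : Finset (Finset V)), (S ∩ X).Nonempty ∧ (S ∩ Y).Nonempty) U W) = {U} := by
    ext W
    simp only [Finset.mem_filter, Finset.mem_singleton]
    constructor
    · exact fun h => (hrel _ _ h.2).symm
    · rintro rfl
      exact ⟨hU, .refl _⟩
  dsimp only
  rw [hflt, Finset.sup_singleton]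

omit [Fintype V] in
theorem touch_subset {𝒜 𝒮 : Finset (Finset V)} {S : Finset V} (hsub : ∀ B ∈ 𝒮, B ⊆ S)
    {X Y : Finset V} (h : Touch 𝒜 𝒮 X Y) : Touch 𝒜 {S} X Y := by
  obtain ⟨hX, hY, B, hB, h1, h2⟩ := h
  exact ⟨hX, hY, S, Finset.mem_singleton_self S,
    h1.mono (Finset.inter_subset_inter_right (hsub B hB)),
    h2.mono (Finset.inter_subset_inter_right (hsub B hB))⟩

theorem eq_of_touch {t : ℝ} {S X Y : Finset V}
    (hS : ∀ v ∈ S, ∀ w ∈ S, I.compAt ε t v = I.compAt ε t w)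
    (h : Touch (I.activeAt ε t) {S} X Y) : X = Y := by
  obtain ⟨hX, hY, B, hB, ⟨x, hx⟩, ⟨y, hy⟩⟩ := h
  rw [Finset.mem_singleton.1 hB] at hx hy
  rw [Finset.mem_inter] at hx hy
  rw [eq_compAt_of_mem (activeAt_subset t hX) hx.2, eq_compAt_of_mem (activeAt_subset t hY) hy.2]
  exact hS x hx.1 y hy.1

theorem mergeBy_eq_of_connects {S : Finset V} (hS : I.ActivelyConnected ε S)
    {𝒮 : Finset (Finset V)} (hsub : ∀ B ∈ 𝒮, B ⊆ S) (hcon : Connects 𝒮 S) {t : ℝ} (ht : 0 ≤ t) :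
    mergeBy (I.activeAt ε t) 𝒮 = mergeBy (I.activeAt ε t) {S} := by
  refine mergeBy_congr (fun X Y h => .rel _ _ (touch_subset hsub h)) fun X Y h => ?_
  -- A chain of vertices gives a chain of merged sets only if all components on the way are active.
  -- If one is not, it contains all of `S`, and `S` merges no two distinct sets.
  by_cases hall : ∀ v ∈ S, I.compAt ε t v ∈ I.activeAt ε t
  · have hchain : ∀ x y, Relation.EqvGen (fun a b => ∃ B ∈ 𝒮, a ∈ B ∧ b ∈ B) x y →
        Relation.EqvGen (Touch (I.activeAt ε t) 𝒮) (I.compAt ε t x) (I.compAt ε t y) := by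
      intro x y hxy
      induction hxy with
      | rel x y hr =>
        obtain ⟨B, hB, hx, hy⟩ := hr
        exact .rel _ _ ⟨hall x (hsub B hB hx), hall y (hsub B hB hy), B, hB,
          ⟨x, Finset.mem_inter.2 ⟨hx, mem_compAt_self t x⟩⟩,
          ⟨y, Finset.mem_inter.2 ⟨hy, mem_compAt_self t y⟩⟩⟩
      | refl x => exact .refl _
      | symm x y _ ih => exact .symm _ _ ih
      | trans x y z _ _ ih₁ ih₂ => exact .trans _ _ _ ih₁ ih₂
    obtain ⟨hX, hY, B, hB, ⟨x, hx⟩, ⟨y, hy⟩⟩ := h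
    rw [Finset.mem_singleton.1 hB] at hx hy
    rw [Finset.mem_inter] at hx hy
    rw [eq_compAt_of_mem (activeAt_subset t hX) hx.2, eq_compAt_of_mem (activeAt_subset t hY) hy.2]
    exact hchain x y (hcon x hx.1 y hy.1)
  · push Not at hall
    obtain ⟨z, hz, hzin⟩ := hall
    have heq := eq_of_touch (fun v hv w hw =>
      (compAt_eq_of_inactive hS ht hz hv hzin).symm.trans
        (compAt_eq_of_inactive hS ht hz hw hzin)) h
    rw [heq]
    exact .refl _

theorem gainRate_eq_of_connects {S : Finset V} (hS : I.ActivelyConnected ε S)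
    {𝒮 : Finset (Finset V)} (hsub : ∀ B ∈ 𝒮, B ⊆ S) (hcon : Connects 𝒮 S) :
    Set.EqOn (I.gainRate ε 𝒮) (I.gainRate ε {S}) (Set.Ici 0) := fun t ht => by
  simp only [gainRate, mergeBy_eq_of_connects hS hsub hcon ht]

theorem gainRate_eq_zero {S : Finset V} {t : ℝ}
    (hS : ∀ v ∈ S, ∀ w ∈ S, I.compAt ε t v = I.compAt ε t w) : I.gainRate ε {S} t = 0 := by
  have h : mergeBy (I.activeAt ε t) {S} = mergeBy (I.activeAt ε t) ∅ := by
    refine mergeBy_congr (fun X Y h => ?_) fun X Y h => ?_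
    · rw [eq_of_touch hS h]
      exact .refl _
    · obtain ⟨-, -, B, hB, -⟩ := h
      simp at hB
  rw [gainRate, h, mergeBy_empty, sub_self]

/-- The rate depends on `t` only through `eventCount`, a monotone function into `ℕ`. -/
theorem measurable_gainRate (𝒮 : Finset (Finset V)) : Measurable (I.gainRate ε 𝒮) := by
  have h : I.gainRate ε 𝒮 = (fun n => ((I.active (I.stateSeq ε n)).card : ℝ)
      - ((mergeBy (I.active (I.stateSeq ε n)) 𝒮).card : ℝ)) ∘ I.eventCount ε := by
    ext t
    simp only [gainRate, activeAt_eq, Function.comp]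
  rw [h]
  exact (measurable_of_countable _).comp (eventCount_mono I ε).measurable

theorem abs_gainRate_le (𝒮 : Finset (Finset V)) (t : ℝ) :
    |I.gainRate ε 𝒮 t| ≤ (Fintype.card (Finset V) : ℝ) := by
  have h1 : ((I.activeAt ε t).card : ℝ) ≤ Fintype.card (Finset V) := by
    exact_mod_cast Finset.card_le_univ _
  have h2 : ((mergeBy (I.activeAt ε t) 𝒮).card : ℝ) ≤ Fintype.card (Finset V) := by
    exact_mod_cast Finset.card_le_univ _
  have h3 : (0 : ℝ) ≤ (I.activeAt ε t).card := Nat.cast_nonneg _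
  have h4 : (0 : ℝ) ≤ (mergeBy (I.activeAt ε t) 𝒮).card := Nat.cast_nonneg _
  rw [gainRate, abs_le]
  constructor <;> linarith

theorem integrableOn_gainRate {S : Finset V} (hS : I.ActivelyConnected ε S) :
    MeasureTheory.IntegrableOn (I.gainRate ε {S}) (Set.Ici 0) := by
  obtain ⟨T, hT⟩ := hS.exists_time
  have h1 : MeasureTheory.IntegrableOn (I.gainRate ε {S}) (Set.Icc 0 T) :=
    MeasureTheory.Measure.integrableOn_of_bounded measure_Icc_lt_top.ne
      (measurable_gainRate {S}).aestronglyMeasurable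
      (Filter.Eventually.of_forall fun t => by
        rw [Real.norm_eq_abs]
        exact abs_gainRate_le {S} t)
  refine h1.of_forall_sdiff_eq_zero measurableSet_Ici fun t ht => gainRate_eq_zero (hT t ?_)
  by_contra! hlt
  exact ht.2 ⟨ht.1, hlt.le⟩

end

end SteinerForest

/-! ### Binary trees, representing leaves and cuts. -/

/-- Full binary trees whose nodes are labelled by vertices. -/
inductive VertexTree (V : Type*)
  | leaf (x : V) : VertexTree V
  | node (v : V) (a b : VertexTree V) : VertexTree V

/-- The properties of the cost of connecting a set of vertices inside `R`. -/
structure IsConnectionCost {V : Type*} [DecidableEq V] (c : Finset V → ℝ) (R : Set V) : Prop where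
  nonneg : ∀ A, 0 ≤ c A
  singleton : ∀ x, c {x} = 0
  mono : ∀ A B : Finset V, A ⊆ B → (B : Set V) ⊆ R → c A ≤ c B
  union : ∀ A B : Finset V, (A : Set V) ⊆ R → (B : Set V) ⊆ R → (A ∩ B).Nonempty →
    c (A ∪ B) ≤ c A + c B

namespace VertexTree

noncomputable section

open scoped Classical

variable {V : Type*}

def root : VertexTree V → V
  | leaf x => x
  | node v _ _ => v

def leaves : VertexTree V → Finset V
  | leaf x => {x}
  | node _ a b => a.leaves ∪ b.leaves

def labels : VertexTree V → Finset V
  | leaf x => {x}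
  | node v a b => insert v (a.labels ∪ b.labels)

/-- The total cost of the edges, where an edge costs as much as connecting its ends. -/
def cost (c : Finset V → ℝ) : VertexTree V → ℝ
  | leaf _ => 0
  | node v a b => c {v, a.root} + a.cost c + (c {v, b.root} + b.cost c)

/-- The leaf reached from the root by always going left. -/
def spineLeaf : VertexTree V → V
  | leaf x => x
  | node _ a _ => a.spineLeaf

/-- The cost of the path from the root to `spineLeaf`. -/
def spineCost (c : Finset V → ℝ) : VertexTree V → ℝ
  | leaf _ => 0
  | node v a _ => c {v, a.root} + a.spineCost c

/-- The leaf reached from the root by going right once and left ever after. -/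
def pathLeaf : VertexTree V → V
  | leaf x => x
  | node _ _ b => b.spineLeaf

/-- The cost of the path from the root to `pathLeaf`. -/
def pathCost (c : Finset V → ℝ) : VertexTree V → ℝ
  | leaf _ => 0
  | node v _ b => c {v, b.root} + b.spineCost c

/-- The sum of the path costs of all subtrees. -/
def totalPathCost (c : Finset V → ℝ) : VertexTree V → ℝ
  | leaf _ => 0
  | node v a b => (node v a b).pathCost c + a.totalPathCost c + b.totalPathCost c

/-- The cost of the pieces that arise by cutting the tree at depth `j` and from then on at every
`(q + 1)`-st level, where the path from each cut node to its `pathLeaf` is paid for once more. -/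
def cutCost (c : Finset V → ℝ) (q : ℕ) : VertexTree V → ℕ → ℝ
  | leaf _, _ => 0
  | node v a b, 0 => (node v a b).pathCost c +
      (c {v, a.root} + a.cutCost c q q + (c {v, b.root} + b.cutCost c q q))
  | node v a b, j + 1 => c {v, a.root} + a.cutCost c q j + (c {v, b.root} + b.cutCost c q j)

theorem root_mem_labels (T : VertexTree V) : T.root ∈ T.labels := by
  cases T <;> simp [root, labels]

theorem leaves_subset_labels (T : VertexTree V) : T.leaves ⊆ T.labels := by
  induction T with
  | leaf x => simp [leaves, labels]
  | node v a b iha ihb => exact (Finset.union_subset_union iha ihb).trans (Finset.subset_insert _ _)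

theorem spineLeaf_mem_leaves (T : VertexTree V) : T.spineLeaf ∈ T.leaves := by
  induction T with
  | leaf x => simp [leaves, spineLeaf]
  | node v a b iha ihb => exact Finset.mem_union_left _ iha

theorem pathLeaf_mem_leaves (T : VertexTree V) : T.pathLeaf ∈ T.leaves := by
  cases T with
  | leaf x => simp [leaves, pathLeaf]
  | node v a b => exact Finset.mem_union_right _ b.spineLeaf_mem_leaves

/-- The paths of all inner nodes and the left spine of the root partition the edges: following left
edges upwards from any edge ends at a right edge, which starts a path, or at the root. -/
theorem totalPathCost_add_spineCost (c : Finset V → ℝ) (T : VertexTree V) :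
    T.totalPathCost c + T.spineCost c = T.cost c := by
  induction T with
  | leaf x => simp [totalPathCost, spineCost, cost]
  | node v a b iha ihb =>
    simp only [totalPathCost, spineCost, cost, pathCost]
    linarith

/-- Each inner node lies on a cut level for exactly one of the `q + 1` offsets, so its path is paid
for once, while the tree is paid for every time. Passing to a child permutes the offsets cyclically.
-/
theorem sum_cutCost (c : Finset V → ℝ) (q : ℕ) (T : VertexTree V) :
    ∑ j ∈ Finset.range (q + 1), T.cutCost c q j = (q + 1) * T.cost c + T.totalPathCost c := by
  induction T with
  | leaf x => simp [cutCost, cost, totalPathCost]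
  | node v a b iha ihb =>
    rw [Finset.sum_range_succ] at iha ihb
    rw [Finset.sum_range_succ']
    simp only [cutCost, Finset.sum_add_distrib, Finset.sum_const, Finset.card_range, nsmul_eq_mul,
      cost, totalPathCost]
    linarith

variable {c : Finset V → ℝ} {R : Set V}

theorem cost_nonneg (hc : IsConnectionCost c R) (T : VertexTree V) : 0 ≤ T.cost c := by
  induction T with
  | leaf x => exact le_rfl
  | node v a b iha ihb =>
    exact add_nonneg (add_nonneg (hc.nonneg _) iha) (add_nonneg (hc.nonneg _) ihb)

theorem spineCost_nonneg (hc : IsConnectionCost c R) (T : VertexTree V) : 0 ≤ T.spineCost c := by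
  induction T with
  | leaf x => exact le_rfl
  | node v a b iha ihb => exact add_nonneg (hc.nonneg _) iha

theorem cost_insert_le (hc : IsConnectionCost c R) {u v : V} {A : Finset V} (hu : u ∈ R)
    (hv : v ∈ R) (hA : (A : Set V) ⊆ R) : c (insert u A) ≤ c {u, v} + c (insert v A) := by
  have h1 : (({u, v} : Finset V) : Set V) ⊆ R := by
    intro x hx
    rcases Finset.mem_insert.1 hx with rfl | hx
    · exact hu
    · exact Finset.mem_singleton.1 hx ▸ hv
  have h2 : ((insert v A : Finset V) : Set V) ⊆ R := by
    rw [Finset.coe_insert]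
    exact Set.insert_subset hv hA
  refine (hc.mono _ _ ?_ ?_).trans (hc.union _ _ h1 h2 ⟨v, by simp⟩)
  · intro x hx
    simp only [Finset.mem_insert, Finset.mem_union, Finset.mem_singleton] at hx ⊢
    tauto
  · rw [Finset.coe_union]
    exact Set.union_subset h1 h2

theorem cost_pair_le (hc : IsConnectionCost c R) {u v w : V} (hu : u ∈ R) (hv : v ∈ R)
    (hw : w ∈ R) : c {u, w} ≤ c {u, v} + c {v, w} :=
  cost_insert_le hc hu hv (by simpa using hw)

theorem labels_left {v : V} {a b : VertexTree V} (h : ((node v a b).labels : Set V) ⊆ R) :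
    (a.labels : Set V) ⊆ R :=
  fun _ hx => h (Finset.mem_insert_of_mem (Finset.mem_union_left _ hx))

theorem labels_right {v : V} {a b : VertexTree V} (h : ((node v a b).labels : Set V) ⊆ R) :
    (b.labels : Set V) ⊆ R :=
  fun _ hx => h (Finset.mem_insert_of_mem (Finset.mem_union_right _ hx))

theorem cost_root_spineLeaf_le (hc : IsConnectionCost c R) (T : VertexTree V)
    (hT : (T.labels : Set V) ⊆ R) : c {T.root, T.spineLeaf} ≤ T.spineCost c := by
  induction T with
  | leaf x => simp [root, spineLeaf, spineCost, hc.singleton]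
  | node v a b iha ihb =>
    have ha := labels_left hT
    refine (cost_pair_le hc (hT (root_mem_labels _)) (ha a.root_mem_labels)
      (ha (a.leaves_subset_labels a.spineLeaf_mem_leaves))).trans ?_
    exact add_le_add le_rfl (iha ha)

theorem cost_root_pathLeaf_le (hc : IsConnectionCost c R) (T : VertexTree V)
    (hT : (T.labels : Set V) ⊆ R) : c {T.root, T.pathLeaf} ≤ T.pathCost c := by
  cases T with
  | leaf x => simp [root, pathLeaf, pathCost, hc.singleton]
  | node v a b =>
    have hb := labels_right hT
    refine (cost_pair_le hc (hT (root_mem_labels _)) (hb b.root_mem_labels)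
      (hb (b.leaves_subset_labels b.spineLeaf_mem_leaves))).trans ?_
    exact add_le_add le_rfl (cost_root_spineLeaf_le hc b hb)

theorem cost_insert_union_le (hc : IsConnectionCost c R) {v : V} {A B : Finset V} {x y : V}
    (hv : v ∈ R) (hx : x ∈ R) (hy : y ∈ R) (hA : (A : Set V) ⊆ R) (hB : (B : Set V) ⊆ R) :
    c (insert v (A ∪ B)) ≤ c {v, x} + c (insert x A) + (c {v, y} + c (insert y B)) := by
  have h1 : insert v (A ∪ B) = insert v A ∪ insert v B := by
    ext z
    simp only [Finset.mem_insert, Finset.mem_union]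
    tauto
  rw [h1]
  refine (hc.union _ _ ?_ ?_ ⟨v, by simp⟩).trans
    (add_le_add (cost_insert_le hc hv hx hA) (cost_insert_le hc hv hy hB))
  · rw [Finset.coe_insert]
    exact Set.insert_subset hv hA
  · rw [Finset.coe_insert]
    exact Set.insert_subset hv hB

/-- The topmost pieces below two siblings are fused into one, which links the two sides. -/
theorem connects_union {L M A B : Finset V} {C D : Finset (Finset V)} (hA : A.Nonempty)
    (hB : B.Nonempty) (hAL : A ⊆ L) (hBM : B ⊆ M) (hL : SteinerForest.Connects (insert A C) L)
    (hM : SteinerForest.Connects (insert B D) M) :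
    SteinerForest.Connects (insert (A ∪ B) (C ∪ D)) (L ∪ M) := by
  have hCL : ∀ x ∈ L, ∀ y ∈ L,
      Relation.EqvGen (fun a b => ∃ E ∈ insert (A ∪ B) (C ∪ D), a ∈ E ∧ b ∈ E) x y := by
    intro x hx y hy
    refine (hL x hx y hy).mono ?_
    rintro a b ⟨E, hE, ha, hb⟩
    rcases Finset.mem_insert.1 hE with rfl | hE
    · exact ⟨_, Finset.mem_insert_self _ _, Finset.mem_union_left _ ha, Finset.mem_union_left _ hb⟩
    · exact ⟨E, Finset.mem_insert_of_mem (Finset.mem_union_left _ hE), ha, hb⟩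
  have hDM : ∀ x ∈ M, ∀ y ∈ M,
      Relation.EqvGen (fun a b => ∃ E ∈ insert (A ∪ B) (C ∪ D), a ∈ E ∧ b ∈ E) x y := by
    intro x hx y hy
    refine (hM x hx y hy).mono ?_
    rintro a b ⟨E, hE, ha, hb⟩
    rcases Finset.mem_insert.1 hE with rfl | hE
    · exact ⟨_, Finset.mem_insert_self _ _, Finset.mem_union_right _ ha,
        Finset.mem_union_right _ hb⟩
    · exact ⟨E, Finset.mem_insert_of_mem (Finset.mem_union_right _ hE), ha, hb⟩
  obtain ⟨p, hp⟩ := hA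
  obtain ⟨q, hq⟩ := hB
  have hpq : Relation.EqvGen (fun a b => ∃ E ∈ insert (A ∪ B) (C ∪ D), a ∈ E ∧ b ∈ E) p q :=
    .rel _ _ ⟨_, Finset.mem_insert_self _ _, Finset.mem_union_left _ hp,
      Finset.mem_union_right _ hq⟩
  have hp' : ∀ x ∈ L ∪ M,
      Relation.EqvGen (fun a b => ∃ E ∈ insert (A ∪ B) (C ∪ D), a ∈ E ∧ b ∈ E) p x := by
    intro x hx
    rcases Finset.mem_union.1 hx with hx | hx
    · exact hCL p (hAL hp) x hx
    · exact hpq.trans _ _ _ (hDM q (hBM hq) x hx)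
  exact fun x hx y hy => ((hp' x hx).symm _ _).trans _ _ _ (hp' y hy)

theorem sum_union_le (hc : IsConnectionCost c R) (C D : Finset (Finset V)) :
    ∑ E ∈ C ∪ D, c E ≤ ∑ E ∈ C, c E + ∑ E ∈ D, c E := by
  rw [← Finset.sum_union_inter]
  exact le_add_of_nonneg_right (Finset.sum_nonneg fun E _ => hc.nonneg E)

theorem sum_insert_le (hc : IsConnectionCost c R) (A : Finset V) (C : Finset (Finset V)) :
    ∑ E ∈ insert A C, c E ≤ c A + ∑ E ∈ C, c E := by
  rw [Finset.insert_eq]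
  simpa using sum_union_le hc {A} C

/-- Cutting at depth `j` and then at every `(q + 1)`-st level: `A` is the set of terminals of the
topmost piece, `C` are the sets of terminals of the other pieces. -/
theorem exists_cut (hc : IsConnectionCost c R) (q : ℕ) (T : VertexTree V) :
    (T.labels : Set V) ⊆ R → ∀ j ≤ q, ∃ (A : Finset V) (C : Finset (Finset V)),
      A.Nonempty ∧ A ⊆ T.leaves ∧ A.card ≤ 2 ^ j ∧
      (∀ B ∈ C, B ⊆ T.leaves ∧ B.card ≤ 2 ^ (q + 1)) ∧
      SteinerForest.Connects (insert A C) T.leaves ∧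
      c (insert T.root A) + ∑ B ∈ C, c B ≤ T.cutCost c q j := by
  induction T with
  | leaf x =>
    intro _ j _
    refine ⟨{x}, ∅, by simp, by simp [leaves], by simpa using Nat.one_le_two_pow, by simp, ?_,
      by simp [root, cutCost, hc.singleton]⟩
    intro y hy z hz
    rw [leaves, Finset.mem_singleton] at hy hz
    rw [hy, hz]
    exact .refl _
  | node v a b iha ihb =>
    intro hT j hj
    have ha := labels_left hT
    have hb := labels_right hT
    have hv : v ∈ R := hT (root_mem_labels _)
    have hsub : ∀ {i : ℕ} {A B : Finset V}, A.card ≤ 2 ^ i → B.card ≤ 2 ^ i →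
        (A ∪ B).card ≤ 2 ^ (i + 1) := fun h1 h2 => by
      refine (Finset.card_union_le _ _).trans ?_
      rw [pow_succ]
      omega
    have hunion : ∀ {P : Finset V → Prop} {C D : Finset (Finset V)}, (∀ B ∈ C, P B) →
        (∀ B ∈ D, P B) → ∀ B ∈ C ∪ D, P B := fun h1 h2 B hB =>
      (Finset.mem_union.1 hB).elim (h1 B) (h2 B)
    have hla : a.leaves ⊆ (node v a b).leaves := Finset.subset_union_left
    have hlb : b.leaves ⊆ (node v a b).leaves := Finset.subset_union_right
    have hlR : ∀ {T' : VertexTree V} {A : Finset V}, (T'.labels : Set V) ⊆ R → A ⊆ T'.leaves →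
        (A : Set V) ⊆ R := fun h1 h2 x hx => h1 (leaves_subset_labels _ (h2 hx))
    cases j with
    | zero =>
      -- A cut at the root: the children's top pieces fuse into the finished piece `A ∪ A'`, and
      -- upwards the root is represented by `pathLeaf` alone, at the price `pathCost`.
      obtain ⟨A, C, hA, hAl, hAc, hC, hcon, hcost⟩ := iha ha q le_rfl
      obtain ⟨A', C', hA', hAl', hAc', hC', hcon', hcost'⟩ := ihb hb q le_rfl
      have hAA : A ∪ A' ⊆ (node v a b).leaves := Finset.union_subset_union hAl hAl'
      refine ⟨{(node v a b).pathLeaf}, insert (A ∪ A') (C ∪ C'), by simp,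
        by simpa using pathLeaf_mem_leaves _, by simp, ?_, ?_, ?_⟩
      · intro B hB
        rcases Finset.mem_insert.1 hB with rfl | hB
        · exact ⟨hAA, hsub hAc hAc'⟩
        · exact hunion (P := fun B => B ⊆ (node v a b).leaves ∧ B.card ≤ 2 ^ (q + 1))
            (fun B hB => ⟨(hC B hB).1.trans hla, (hC B hB).2⟩)
            (fun B hB => ⟨(hC' B hB).1.trans hlb, (hC' B hB).2⟩) B hB
      -- The finished pieces already connect all leaves, among them `pathLeaf`.
      · intro x hx y hy
        refine (connects_union hA hA' hAl hAl' hcon hcon' x hx y hy).mono ?_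
        rintro p r ⟨E, hE, h⟩
        exact ⟨E, Finset.mem_insert_of_mem hE, h⟩
      · have h1 := cost_root_pathLeaf_le hc _ hT
        have h2 := sum_insert_le hc (A ∪ A') (C ∪ C')
        have h3 := sum_union_le hc C C'
        have h4 := cost_insert_union_le hc hv (ha a.root_mem_labels) (hb b.root_mem_labels)
          (hlR ha hAl) (hlR hb hAl')
        have h5 : c (A ∪ A') ≤ c (insert v (A ∪ A')) := hc.mono _ _ (Finset.subset_insert _ _) (by
          rw [Finset.coe_insert]
          exact Set.insert_subset hv (hlR hT hAA))
        simp only [cutCost]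
        linarith
    | succ j =>
      obtain ⟨A, C, hA, hAl, hAc, hC, hcon, hcost⟩ := iha ha j (by omega)
      obtain ⟨A', C', hA', hAl', hAc', hC', hcon', hcost'⟩ := ihb hb j (by omega)
      refine ⟨A ∪ A', C ∪ C', hA.mono Finset.subset_union_left,
        Finset.union_subset_union hAl hAl', hsub hAc hAc',
        hunion (fun B hB => ⟨(hC B hB).1.trans hla, (hC B hB).2⟩)
          (fun B hB => ⟨(hC' B hB).1.trans hlb, (hC' B hB).2⟩),
        connects_union hA hA' hAl hAl' hcon hcon', ?_⟩
      have h3 := sum_union_le hc C C'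
      have h4 := cost_insert_union_le hc hv (ha a.root_mem_labels) (hb b.root_mem_labels)
        (hlR ha hAl) (hlR hb hAl')
      simp only [cutCost]
      change c (insert v (A ∪ A')) + _ ≤ _
      linarith

theorem exists_restricted (hc : IsConnectionCost c R) (q : ℕ) (T : VertexTree V)
    (hT : (T.labels : Set V) ⊆ R) : ∃ C : Finset (Finset V),
      (∀ B ∈ C, B ⊆ T.leaves ∧ B.card ≤ 2 ^ (q + 1)) ∧ SteinerForest.Connects C T.leaves ∧
      ∑ B ∈ C, c B ≤ (1 + 1 / ((q + 1 : ℕ) : ℝ)) * T.cost c := by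
  have hsum : ∑ j ∈ Finset.range (q + 1), T.cutCost c q j
      ≤ ∑ _j ∈ Finset.range (q + 1), (1 + 1 / ((q + 1 : ℕ) : ℝ)) * T.cost c := by
    have h1 := totalPathCost_add_spineCost c T
    have h2 := spineCost_nonneg hc T
    rw [sum_cutCost, Finset.sum_const, Finset.card_range, nsmul_eq_mul]
    have h3 : ((q + 1 : ℕ) : ℝ) * ((1 + 1 / ((q + 1 : ℕ) : ℝ)) * T.cost c)
        = (q + 1) * T.cost c + T.cost c := by
      push_cast
      field_simp
    linarith
  -- Some offset costs at most the average.
  obtain ⟨j, hj, hle⟩ := Finset.exists_le_of_sum_le (by simp) hsum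
  have hjq : j ≤ q := by
    have := Finset.mem_range.1 hj
    omega
  obtain ⟨A, C, hA, hAl, hAc, hC, hcon, hcost⟩ := exists_cut hc q T hT j hjq
  refine ⟨insert A C, ?_, hcon, ?_⟩
  · intro B hB
    rcases Finset.mem_insert.1 hB with rfl | hB
    · exact ⟨hAl, hAc.trans (Nat.pow_le_pow_right (by norm_num) (by omega))⟩
    · exact hC B hB
  · have h1 := sum_insert_le hc A C
    have h2 : c A ≤ c (insert T.root A) := hc.mono _ _ (Finset.subset_insert _ _) (by
      rw [Finset.coe_insert]
      exact Set.insert_subset (hT T.root_mem_labels)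
        fun x hx => hT (T.leaves_subset_labels (hAl hx)))
    linarith

/-! ### From a connected edge set to a binary tree with prescribed leaves. -/

/-- A leaf `u` is replaced by a node labelled `u` with leaves `u` and `w`. The edge between the two
copies of `u` is free, so `u` stays a leaf at no cost. -/
theorem exists_attach (hc : IsConnectionCost c R) (T : VertexTree V) {u : V} (w : V)
    (hu : u ∈ T.leaves) : ∃ T' : VertexTree V, T'.root = T.root ∧ T'.leaves = insert w T.leaves ∧
      T'.labels = insert w T.labels ∧ T'.cost c = T.cost c + c {u, w} := by
  induction T with
  | leaf x =>
    rw [leaves, Finset.mem_singleton] at hu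
    subst hu
    refine ⟨node u (leaf u) (leaf w), rfl, ?_, ?_, ?_⟩
    · ext z
      simp [leaves, or_comm]
    · ext z
      simp only [labels, Finset.mem_insert, Finset.mem_union, Finset.mem_singleton]
      tauto
    · simp [cost, root, hc.singleton]
  | node v a b iha ihb =>
    rcases Finset.mem_union.1 hu with hu | hu
    · obtain ⟨a', h1, h2, h3, h4⟩ := iha hu
      refine ⟨node v a' b, rfl, ?_, ?_, ?_⟩
      · simp only [leaves, h2, Finset.insert_union]
      · simp only [labels, h3, Finset.insert_union, Finset.insert_comm]
      · simp only [cost, h1, h4]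
        ring
    · obtain ⟨b', h1, h2, h3, h4⟩ := ihb hu
      refine ⟨node v a b', rfl, ?_, ?_, ?_⟩
      · simp only [leaves, h2, Finset.union_insert]
      · simp only [labels, h3, Finset.union_insert, Finset.insert_comm]
      · simp only [cost, h1, h4]
        ring

/-- Subtrees without leaves in `S` are deleted and nodes left with one child are contracted. This
may move the root down; the term `c {T.root, T'.root}` pays for the detour, so that the parent can
reroute its edge by the triangle inequality. -/
theorem exists_prune (hc : IsConnectionCost c R) (S : Finset V) (T : VertexTree V) :
    (T.labels : Set V) ⊆ R → (T.leaves ∩ S).Nonempty → ∃ T' : VertexTree V,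
      T'.labels ⊆ T.labels ∧ T'.leaves = T.leaves ∩ S ∧
      c {T.root, T'.root} + T'.cost c ≤ T.cost c := by
  induction T with
  | leaf x =>
    intro _ hne
    refine ⟨leaf x, Finset.Subset.refl _, ?_, by simp [root, cost, hc.singleton]⟩
    obtain ⟨y, hy⟩ := hne
    rw [leaves, Finset.mem_inter, Finset.mem_singleton] at hy
    obtain ⟨rfl, hy⟩ := hy
    exact (Finset.inter_eq_left.2 (Finset.singleton_subset_iff.2 hy)).symm
  | node v a b iha ihb =>
    intro hT hne
    have ha := labels_left hT
    have hb := labels_right hT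
    have hv : v ∈ R := hT (root_mem_labels _)
    have hla : a.labels ⊆ (node v a b).labels :=
      Finset.subset_union_left.trans (Finset.subset_insert _ _)
    have hlb : b.labels ⊆ (node v a b).labels :=
      Finset.subset_union_right.trans (Finset.subset_insert _ _)
    have htri : ∀ {d d' : VertexTree V}, (d.labels : Set V) ⊆ R → d'.labels ⊆ d.labels →
        c {v, d'.root} ≤ c {v, d.root} + c {d.root, d'.root} := fun h1 h2 =>
      cost_pair_le hc hv (h1 (root_mem_labels _)) (h1 (h2 (root_mem_labels _)))
    have hl : (node v a b).leaves ∩ S = (a.leaves ∩ S) ∪ (b.leaves ∩ S) :=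
      Finset.union_inter_distrib_right _ _ _
    have hr : (node v a b).root = v := rfl
    rw [hl] at hne ⊢
    rw [hr]
    by_cases hna : (a.leaves ∩ S).Nonempty
    · obtain ⟨a', ha1, ha2, ha3⟩ := iha ha hna
      have hta := htri ha ha1
      by_cases hnb : (b.leaves ∩ S).Nonempty
      · obtain ⟨b', hb1, hb2, hb3⟩ := ihb hb hnb
        have htb := htri hb hb1
        refine ⟨node v a' b', Finset.insert_subset_insert _ (Finset.union_subset_union ha1 hb1),
          by rw [leaves, ha2, hb2], ?_⟩
        rw [show (node v a' b').root = v from rfl, Finset.pair_eq_singleton, hc.singleton]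
        simp only [cost]
        linarith
      · refine ⟨a', ha1.trans hla, ?_, ?_⟩
        · rw [ha2, Finset.not_nonempty_iff_eq_empty.1 hnb, Finset.union_empty]
        · have h1 := cost_nonneg hc b
          have h2 := hc.nonneg {v, b.root}
          simp only [cost]
          linarith
    · rw [Finset.not_nonempty_iff_eq_empty.1 hna, Finset.empty_union] at hne ⊢
      obtain ⟨b', hb1, hb2, hb3⟩ := ihb hb hne
      have htb := htri hb hb1
      refine ⟨b', hb1.trans hlb, hb2, ?_⟩
      have h1 := cost_nonneg hc a
      have h2 := hc.nonneg {v, a.root}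
      simp only [cost]
      linarith

theorem exists_spanning [Fintype V] (hc : IsConnectionCost c R) {F : Finset (Sym2 V)}
    {g : Sym2 V → ℝ} (hg : ∀ e ∈ F, 0 ≤ g e) (hcg : ∀ u w, s(u, w) ∈ F → c {u, w} ≤ g s(u, w))
    (hRF : ∀ u w, u ∈ R → s(u, w) ∈ F → w ∈ R) {v : V} (hv : v ∈ R) :
    ∃ T : VertexTree V, (T.labels : Set V) ⊆ R ∧
      (∀ w, (SimpleGraph.fromEdgeSet (F : Set (Sym2 V))).Reachable v w → w ∈ T.leaves) ∧
      T.cost c ≤ ∑ e ∈ F, g e := by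
  -- A leaf set of maximal size is taken. Charging only edges with both ends in `L` leaves every
  -- boundary edge unpaid, so a further vertex could be attached along one.
  let P : Finset V → Prop := fun L => v ∈ L ∧ ∃ T : VertexTree V, (T.labels : Set V) ⊆ R ∧
    T.leaves = L ∧ T.cost c ≤ ∑ e ∈ F with ∀ x ∈ e, x ∈ L, g e
  have hP : (Finset.univ.filter P).Nonempty :=
    ⟨{v}, Finset.mem_filter.2 ⟨Finset.mem_univ _, Finset.mem_singleton_self v, leaf v,
      by simpa [labels] using hv, rfl,
      Finset.sum_nonneg fun e he => hg e (Finset.mem_filter.1 he).1⟩⟩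
  obtain ⟨L, hL, hmax⟩ := Finset.exists_max_image _ Finset.card hP
  obtain ⟨hvL, T, hT, rfl, hcost⟩ := (Finset.mem_filter.1 hL).2
  refine ⟨T, hT, ?_, hcost.trans (Finset.sum_le_sum_of_subset_of_nonneg (Finset.filter_subset _ _)
    fun e he _ => hg e he)⟩
  rintro w ⟨p⟩
  by_contra hw
  obtain ⟨⟨⟨x, y⟩, hadj⟩, -, hx, hy⟩ := p.exists_boundary_dart (T.leaves : Set V) hvL hw
  change x ∈ T.leaves at hx
  change y ∉ T.leaves at hy
  have hxy : s(x, y) ∈ F := ((SimpleGraph.fromEdgeSet_adj _).1 hadj).1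
  obtain ⟨T', -, h2, h3, h4⟩ := exists_attach hc T y hx
  have hyR : y ∈ R := hRF x y (hT (T.leaves_subset_labels hx)) hxy
  have hP' : P (insert y T.leaves) := by
    refine ⟨Finset.mem_insert_of_mem hvL, T', ?_, h2, ?_⟩
    · rw [h3, Finset.coe_insert]
      exact Set.insert_subset hyR hT
    · have hnot : s(x, y) ∉ F.filter fun e => ∀ x ∈ e, x ∈ T.leaves := fun h =>
        hy ((Finset.mem_filter.1 h).2 y (Sym2.mem_mk_right x y))
      have hsub : insert s(x, y) (F.filter fun e => ∀ x ∈ e, x ∈ T.leaves)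
          ⊆ F.filter fun e => ∀ x ∈ e, x ∈ insert y T.leaves := by
        intro e he
        rw [Finset.mem_filter]
        rcases Finset.mem_insert.1 he with rfl | he
        · refine ⟨hxy, fun z hz => ?_⟩
          rcases Sym2.mem_iff.1 hz with rfl | rfl
          · exact Finset.mem_insert_of_mem hx
          · exact Finset.mem_insert_self _ _
        · obtain ⟨heF, he⟩ := Finset.mem_filter.1 he
          exact ⟨heF, fun z hz => Finset.mem_insert_of_mem (he z hz)⟩
      have hle := Finset.sum_le_sum_of_subset_of_nonneg (f := g) hsub
        fun e he _ => hg e (Finset.mem_filter.1 he).1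
      rw [Finset.sum_insert hnot] at hle
      have := hcg x y hxy
      linarith
  have hcard := hmax _ (Finset.mem_filter.2 ⟨Finset.mem_univ _, hP'⟩)
  rw [Finset.card_insert_of_notMem hy] at hcard
  omega

end

end VertexTree

/-! ### Steiner costs and restricted Steiner trees. -/

namespace SteinerForest

noncomputable section

open scoped Classical

variable {V : Type*} [Fintype V] (I : SteinerForest V)

/-- `F` is a set of edges of the graph that connects all vertices of `S`. -/
def Joins (F : Finset (Sym2 V)) (S : Finset V) : Prop :=
  (F : Set (Sym2 V)) ⊆ I.graph.edgeSet ∧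
    ∀ u ∈ S, ∀ v ∈ S, (SimpleGraph.fromEdgeSet (F : Set (Sym2 V))).Reachable u v

variable {I}

omit [Fintype V] in
theorem Joins.sum_nonneg {F : Finset (Sym2 V)} {S : Finset V} (h : I.Joins F S) :
    0 ≤ ∑ e ∈ F, I.cost e :=
  Finset.sum_nonneg fun e he => I.cost_nonneg e (h.1 he)

omit [Fintype V] in
theorem Joins.steinerCost_le {F : Finset (Sym2 V)} {S : Finset V} (h : I.Joins F S) :
    I.steinerCost S ≤ ∑ e ∈ F, I.cost e := by
  refine csInf_le ⟨0, ?_⟩ ⟨F, h.1, h.2, rfl⟩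
  rintro x ⟨F', h1, h2, rfl⟩
  exact Joins.sum_nonneg ⟨h1, h2⟩

omit [Fintype V] in
theorem steinerCost_nonneg (S : Finset V) : 0 ≤ I.steinerCost S := by
  apply Real.sInf_nonneg
  rintro x ⟨F, h1, h2, rfl⟩
  exact Joins.sum_nonneg ⟨h1, h2⟩

theorem exists_joins_eq {S : Finset V} {v : V} (hS : (S : Set V) ⊆ {w | I.graph.Reachable v w}) :
    ∃ F, I.Joins F S ∧ ∑ e ∈ F, I.cost e = I.steinerCost S := by
  have hne : {x : ℝ | ∃ F : Finset (Sym2 V), (F : Set (Sym2 V)) ⊆ I.graph.edgeSet ∧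
      (∀ u ∈ S, ∀ v ∈ S, (SimpleGraph.fromEdgeSet (F : Set (Sym2 V))).Reachable u v) ∧
      x = ∑ e ∈ F, I.cost e}.Nonempty := by
    refine ⟨_, Finset.univ.filter fun e => e ∈ I.graph.edgeSet, by simp, ?_, rfl⟩
    intro u hu w hw
    have h : ((Finset.univ.filter fun e => e ∈ I.graph.edgeSet : Finset (Sym2 V)) : Set (Sym2 V))
        = I.graph.edgeSet := by
      ext e
      simp
    rw [h, SimpleGraph.fromEdgeSet_edgeSet]
    exact (hS hu).symm.trans (hS hw)
  have hfin : {x : ℝ | ∃ F : Finset (Sym2 V), (F : Set (Sym2 V)) ⊆ I.graph.edgeSet ∧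
      (∀ u ∈ S, ∀ v ∈ S, (SimpleGraph.fromEdgeSet (F : Set (Sym2 V))).Reachable u v) ∧
      x = ∑ e ∈ F, I.cost e}.Finite := by
    refine (Set.finite_range fun F : Finset (Sym2 V) => ∑ e ∈ F, I.cost e).subset ?_
    rintro x ⟨F, -, -, rfl⟩
    exact ⟨F, rfl⟩
  obtain ⟨F, h1, h2, h3⟩ := hne.csInf_mem hfin
  exact ⟨F, ⟨h1, h2⟩, h3.symm⟩

/-- The restriction to one component of the graph matters: a set that cannot be connected has cost
`sInf ∅ = 0`, which would break monotonicity. -/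
theorem isConnectionCost_steinerCost (I : SteinerForest V) (v : V) :
    IsConnectionCost I.steinerCost {w | I.graph.Reachable v w} where
  nonneg := steinerCost_nonneg
  singleton x := by
    apply le_antisymm _ (steinerCost_nonneg _)
    have h : I.Joins ∅ {x} := by
      refine ⟨by simp, fun u hu w hw => ?_⟩
      rw [Finset.mem_singleton.1 hu, Finset.mem_singleton.1 hw]
    simpa using h.steinerCost_le
  mono A B hAB hB := by
    obtain ⟨F, hF, hcost⟩ := exists_joins_eq hB
    rw [← hcost]
    exact Joins.steinerCost_le ⟨hF.1, fun u hu w hw => hF.2 u (hAB hu) w (hAB hw)⟩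
  union A B hA hB hAB := by
    obtain ⟨F, hF, hcost⟩ := exists_joins_eq hA
    obtain ⟨F', hF', hcost'⟩ := exists_joins_eq hB
    obtain ⟨z, hz⟩ := hAB
    rw [Finset.mem_inter] at hz
    have hz' : ∀ u ∈ A ∪ B,
        (SimpleGraph.fromEdgeSet ((F ∪ F' : Finset (Sym2 V)) : Set (Sym2 V))).Reachable u z := by
      intro u hu
      rcases Finset.mem_union.1 hu with hu | hu
      · exact (hF.2 u hu z hz.1).mono (SimpleGraph.fromEdgeSet_mono (by simp))
      · exact (hF'.2 u hu z hz.2).mono (SimpleGraph.fromEdgeSet_mono (by simp))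
    have hJ : I.Joins (F ∪ F') (A ∪ B) := by
      refine ⟨?_, fun u hu w hw => (hz' u hu).trans (hz' w hw).symm⟩
      rw [Finset.coe_union]
      exact Set.union_subset hF.1 hF'.1
    refine hJ.steinerCost_le.trans ?_
    rw [← hcost, ← hcost', ← Finset.sum_union_inter]
    exact le_add_of_nonneg_right (Finset.sum_nonneg fun e he =>
      I.cost_nonneg e (hF.1 (Finset.mem_inter.1 he).1))

omit [Fintype V] in
theorem steinerCost_edge_le {u w : V} (h : s(u, w) ∈ I.graph.edgeSet) :
    I.steinerCost {u, w} ≤ I.cost s(u, w) := by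
  have hadj : (SimpleGraph.fromEdgeSet (({s(u, w)} : Finset (Sym2 V)) : Set (Sym2 V))).Adj u w := by
    rw [SimpleGraph.fromEdgeSet_adj]
    exact ⟨by simp, h.ne⟩
  have hJ : I.Joins {s(u, w)} {u, w} := by
    refine ⟨by simpa using h, fun x hx y hy => ?_⟩
    have hu : ∀ z ∈ ({u, w} : Finset V),
        (SimpleGraph.fromEdgeSet (({s(u, w)} : Finset (Sym2 V)) : Set (Sym2 V))).Reachable u z := by
      intro z hz
      rcases Finset.mem_insert.1 hz with rfl | hz
      · exact .refl _
      · rw [Finset.mem_singleton.1 hz]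
        exact hadj.reachable
    exact (hu x hx).symm.trans (hu y hy)
  simpa using hJ.steinerCost_le

/-- Connected components of bounded size that are almost as cheap as a Steiner tree. -/
theorem exists_restricted_steiner_tree {k : ℕ} (hk : 2 ≤ k) {S : Finset V} {v : V} (hv : v ∈ S)
    (hS : (S : Set V) ⊆ {w | I.graph.Reachable v w}) : ∃ 𝒮 : Finset (Finset V),
      (∀ A ∈ 𝒮, A ⊆ S ∧ A.card ≤ k) ∧ Connects 𝒮 S ∧
      I.collectionCost 𝒮 ≤ (1 + 1 / (Nat.log 2 k : ℝ)) * I.steinerCost S := by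
  have hc := isConnectionCost_steinerCost I v
  obtain ⟨F, hF, hcost⟩ := exists_joins_eq hS
  obtain ⟨T, hT, hreach, hTF⟩ := VertexTree.exists_spanning hc (F := F) (g := I.cost)
    (fun e he => I.cost_nonneg e (hF.1 he)) (fun u w h => steinerCost_edge_le (hF.1 h))
    (fun u w (hu : I.graph.Reachable v u) h =>
      hu.trans (SimpleGraph.Adj.reachable (I.graph.mem_edgeSet.1 (hF.1 h)))) (v := v)
    (SimpleGraph.Reachable.refl v)
  have hTS : T.leaves ∩ S = S := Finset.inter_eq_right.2 fun w hw => hreach w (hF.2 v hv w hw)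
  obtain ⟨T', hT', hl, hle⟩ := VertexTree.exists_prune hc S T hT (by rw [hTS]; exact ⟨v, hv⟩)
  rw [hTS] at hl
  -- The logarithm is positive as `k ≥ 2`; with `q + 1 = Nat.log 2 k` the pieces have at most `2 ^
  -- (q + 1) ≤ k` elements.
  obtain ⟨q, hq⟩ := Nat.exists_eq_add_one.2 (Nat.log_pos one_lt_two hk)
  obtain ⟨C, hC, hcon, hsum⟩ := VertexTree.exists_restricted hc q T'
    ((Finset.coe_subset.2 hT').trans hT)
  rw [hl] at hC hcon
  refine ⟨C, fun A hA => ⟨(hC A hA).1, (hC A hA).2.trans ?_⟩, hcon, hsum.trans ?_⟩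
  · rw [← hq]
    exact Nat.pow_log_le_self 2 (by omega)
  · rw [← hq]
    have h1 := hc.nonneg {T.root, T'.root}
    exact mul_le_mul_of_nonneg_left (by linarith) (by positivity)

/-- Eventually `S` lies in one component of the tight edges, which are edges of the graph. -/
theorem ActivelyConnected.reachable {ε : ℝ} {S : Finset V} (hS : I.ActivelyConnected ε S) {v w : V}
    (hv : v ∈ S) (hw : w ∈ S) : I.graph.Reachable v w := by
  obtain ⟨t, ht⟩ := hS.exists_time
  refine (compOf_eq_iff.1 (ht t le_rfl v hv w hw)).mono ?_
  rw [tightGraph, ← I.graph.fromEdgeSet_edgeSet]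
  apply SimpleGraph.fromEdgeSet_mono
  rintro e ⟨he, -⟩
  simpa using he

end

end SteinerForest

theorem mainTheorem8 {V : Type*} [Fintype V] (I : SteinerForest V) (ε : ℝ) (hε : 0 ≤ ε)
    (k : ℕ) (hk : 2 ≤ k) (S : Finset V) (hS : I.ActivelyConnected ε S) :
    ∃ 𝒮 : Finset (Finset V),
      (∀ A ∈ 𝒮, A ⊆ S ∧ A.card ≤ k) ∧
      I.collectionCost 𝒮 ≤ (1 + 1 / (Nat.log 2 k : ℝ)) * I.steinerCost S ∧
      MeasureTheory.IntegrableOn (I.gainRate ε 𝒮) (Set.Ici 0) ∧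
      MeasureTheory.IntegrableOn (I.gainRate ε {S}) (Set.Ici 0) ∧
      I.gain ε 𝒮 = I.gain ε {S} := by
  obtain ⟨𝒮, hsub, hcon, hcost⟩ : ∃ 𝒮 : Finset (Finset V), (∀ A ∈ 𝒮, A ⊆ S ∧ A.card ≤ k) ∧
      SteinerForest.Connects 𝒮 S ∧
      I.collectionCost 𝒮 ≤ (1 + 1 / (Nat.log 2 k : ℝ)) * I.steinerCost S := by
    -- A binary tree has at least one leaf, so the empty set is treated apart, with the empty
    -- collection.
    rcases S.eq_empty_or_nonempty with rfl | ⟨v, hv⟩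
    · refine ⟨∅, by simp, fun x hx => by simp at hx, ?_⟩
      have := SteinerForest.steinerCost_nonneg (I := I) ∅
      rw [SteinerForest.collectionCost, Finset.sum_empty]
      positivity
    · exact SteinerForest.exists_restricted_steiner_tree hk hv fun w hw => hS.reachable hv hw
  have heq := SteinerForest.gainRate_eq_of_connects hS (fun B hB => (hsub B hB).1) hcon
  have hint := SteinerForest.integrableOn_gainRate hS
  refine ⟨𝒮, hsub, hcost, hint.congr_fun heq.symm measurableSet_Ici, hint, ?_⟩
  rw [SteinerForest.gain, SteinerForest.gain, MeasureTheory.setIntegral_congr_fun measurableSet_Ici heq]
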